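/- Let $f:[a,b]\to[a,b]$ ($a<b$) be a piecewise linear expanding Markov map: there are nondegenerate closed intervals $I_1,\dots,I_N$ with pairwise disjoint interiors and union $[a,b]$ such that, for all $k,l$, either $f(\operatorname{int} I_k)\cap\operatorname{int} I_l=\emptyset$ or $\operatorname{int} I_l\subseteq f(\operatorname{int} I_k)$, and for each $k$ there is a constant $\gamma_k\in\mathbb R$ with $|\gamma_k|>1$ and $f'(x)=\gamma_k$ for all $x\in\operatorname{int} I_k$. Write $f(x)=\gamma_k x+d_k$ on $\operatorname{int} I_k$, let $A_{kl}=1$ if $\operatorname{int} I_l\subseteq f(\operatorname{int} I_k)$ and $A_{kl}=0$ otherwise, and for $A_{lk}=1$ let $\varphi_{kl}(z)=(z-d_l)/\gamma_l$ be the (analytically continued) inverse branch from $I_k$ into $I_l$. Let $D_r\subset D_R$ be concentric open disks in $\mathbb C$ of radii $0<r<R$ such that $\varphi_{kl}(D_R)\subset D_r$ for all inverse branches. Let $H^\infty(D_R)$ be the Banach space of bounded holomorphic functions on $D_R$ with the supremum norm, $\mathcal H(D_R)=\bigoplus_{k=1}^N H^\infty(D_R)$ with the maximum norm, and for $\beta\in\mathbb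 R$ let $\mathcal L_\beta:\mathcal H(D_R)\to\mathcal H(D_R)$ be the bounded transfer operator $$(\mathcal L_\beta h)_k(z)=\sum_{l=1}^N A_{lk}\,|\gamma_l|^{-\beta}\,h_l(\varphi_{kl}(z)),$$ where terms with $A_{lk}=0$ are omitted; for $x\in\operatorname{int} I_k$ this is $(\mathcal L_\beta h)(x)=\sum_{y\in f^{-1}(x)}h(y)/|f'(y)|^{\beta}$, the sum being over the preimages $y$ in the interiors of the $I_l$ and $h(y)$ meaning $h_l(y)$ for $y\in\operatorname{int} I_l$. For $m\ge 0$ let $T^{(mm)}(\beta)$ be the $N\times N$ matrix with entries $$T^{(mm)}_{kl}(\beta)=\frac{A_{lk}}{|\gamma_l|^\beta\gamma_l^m}.$$ Suppose that $f$ is topologically mixing, that is, for some integer $p\ge1$ all entries of $A^p$ are positive. Then, for every real $\beta$, there is a real number $\nu_0(\beta)>0$ such that: (i) $\nu_0(\beta)$ is a simple leading eigenvalue of $\mathcal L_\beta$ on $\mathcal H(D_R)$: it is an eigenvalue of algebraic multiplicity one, and every other point $\mu$ of the spectrum of $\mathcal L_\beta$ satisfies $|\mu|<\nu_0(\beta)$;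 (ii) $\nu_0(\beta)$ is the Perron eigenvalue of $T^{(00)}(\beta)$: it is a simple root of the characteristic polynomial, and every other complex eigenvalue $\mu$ of $T^{(00)}(\beta)$ satisfies $|\mu|<\nu_0(\beta)$; (iii) with $C=1/\inf_l|\gamma_l|$ one has $C<1$, and for every $m\ge1$ the spectral radius of $T^{(mm)}(\beta)$ satisfies $r(T^{(mm)}(\beta))\le C\,\nu_0(\beta)$. -/

import Mathlib

noncomputable section

namespace MarkovTransfer

/-- A piecewise linear expanding Markov map `f` of the closed interval `[a, b]`, with Markov
partition into the `N` nondegenerate closed intervals `[lo k, hi k]`. The derivative of `f` on the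
open interval `(lo k, hi k)` is the constant `slope k`; the values of `f` at the endpoints of the
partition intervals are not constrained beyond lying in `[a, b]`, and those of `f` outside `[a, b]`
play no role. -/
structure PLExpandingMarkovMap (N : ℕ) where
  a : ℝ
  b : ℝ
  a_lt_b : a < b
  f : ℝ → ℝ
  mapsTo : Set.MapsTo f (Set.Icc a b) (Set.Icc a b)
  lo : Fin N → ℝ
  hi : Fin N → ℝ
  lo_lt_hi : ∀ k, lo k < hi k
  disjoint_interiors : ∀ k l, k ≠ l → Disjoint (Set.Ioo (lo k) (hi k)) (Set.Ioo (lo l) (hi l))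
  iUnion_eq : ⋃ k, Set.Icc (lo k) (hi k) = Set.Icc a b
  markov : ∀ k l, f '' Set.Ioo (lo k) (hi k) ∩ Set.Ioo (lo l) (hi l) = ∅ ∨
    Set.Ioo (lo l) (hi l) ⊆ f '' Set.Ioo (lo k) (hi k)
  slope : Fin N → ℝ
  hasDerivAt : ∀ k, ∀ x ∈ Set.Ioo (lo k) (hi k), HasDerivAt f (slope k) x
  expanding : ∀ k, 1 < |slope k|

/-- The Banach space `H^∞(D)` of bounded holomorphic functions on the open disk `D` with centre `c`
and radius `R`, with the supremum norm. -/
def HInf (c : ℂ) (R : ℝ) :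
    Submodule ℂ (BoundedContinuousFunction (Metric.ball c R) ℂ) where
  carrier := {h | ∃ g : ℂ → ℂ, DifferentiableOn ℂ g (Metric.ball c R) ∧
    ∀ z : Metric.ball c R, h z = g z}
  add_mem' := by
    rintro h₁ h₂ ⟨g₁, d₁, e₁⟩ ⟨g₂, d₂, e₂⟩
    exact ⟨fun z => g₁ z + g₂ z, d₁.add d₂, fun z => by simp [e₁, e₂]⟩
  zero_mem' := ⟨fun _ => 0, differentiableOn_const 0, fun z => by simp⟩
  smul_mem' := by
    rintro t h ⟨g, d, e⟩
    exact ⟨fun z => t * g z, d.const_mul t, fun z => by simp [e]⟩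

/-- The space `𝓗(D)` of `N`-tuples of bounded holomorphic functions on the disk `D`; the norm is the
maximum of the norms of the components. -/
abbrev HSpace (N : ℕ) (c : ℂ) (R : ℝ) : Type := Fin N → HInf c R

/-- The value of `h ∈ H^∞(D)` at a point of `D` (and `0` off `D`). -/
def HInf.eval {c : ℂ} {R : ℝ} (h : HInf c R) (z : ℂ) : ℂ :=
  open Classical in if hz : z ∈ Metric.ball c R then h.1 ⟨z, hz⟩ else 0

namespace PLExpandingMarkovMap

variable {N : ℕ} (M : PLExpandingMarkovMap N)

/-- The topological transition matrix `A` of the Markov map. -/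
def transitionMatrix : Matrix (Fin N) (Fin N) ℝ :=
  open Classical in
  Matrix.of fun k l =>
    if Set.Ioo (M.lo l) (M.hi l) ⊆ M.f '' Set.Ioo (M.lo k) (M.hi k) then 1 else 0

/-- Topological mixing: some positive power of the transition matrix is entrywise positive. -/
def IsTopologicallyMixing : Prop :=
  ∃ p : ℕ, 0 < p ∧ ∀ k l, 0 < (M.transitionMatrix ^ p) k l

/-- The intercept `d_k` of the branch `f(x) = slope k * x + d_k` of `f` over `(lo k, hi k)`, read
off at the midpoint. -/
def intercept (k : Fin N) : ℝ :=
  M.f ((M.lo k + M.hi k) / 2) - M.slope k * ((M.lo k + M.hi k) / 2)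

/-- The analytic continuation to the complex plane of the inverse branches `φ_{kl}` from the
partition element `k` into the partition element `l`; being the inverse of the affine branch over
`l`, it does not depend on `k`. -/
def invBranch (l : Fin N) (z : ℂ) : ℂ := (z - M.intercept l) / M.slope l

/-- The diagonal blocks `T^{(mm)}(β)`, with entries `A_{lk} / (|γ_l|^β γ_l^m)`. -/
def diagBlock (m : ℕ) (β : ℝ) : Matrix (Fin N) (Fin N) ℝ :=
  Matrix.of fun k l => M.transitionMatrix l k / (|M.slope l| ^ β * M.slope l ^ m)

/-- Concentric open disks `D_r` and `D_R`, `0 < r < R`, such that every inverse branch `φ_{kl}`,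
that is, for each pair with `A_{lk} = 1`, maps `D_R` into `D_r`. -/
structure AdaptedDisks where
  c : ℂ
  r : ℝ
  R : ℝ
  r_pos : 0 < r
  r_lt_R : r < R
  mapsTo : ∀ k l, M.transitionMatrix l k = 1 →
    Set.MapsTo (M.invBranch l) (Metric.ball c R) (Metric.ball c r)

theorem eq_affine (l : Fin N) {x : ℝ} (hx : x ∈ Set.Ioo (M.lo l) (M.hi l)) :
    M.f x = M.slope l * x + M.intercept l := by
  have hm : (M.lo l + M.hi l) / 2 ∈ Set.Ioo (M.lo l) (M.hi l) := by
    have := M.lo_lt_hi l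
    constructor <;> linarith
  have hd : ∀ y ∈ Set.Ioo (M.lo l) (M.hi l),
      HasDerivAt (fun y => M.f y - M.slope l * y) 0 y := by
    intro y hy
    have := (M.hasDerivAt l y hy).sub ((hasDerivAt_id y).const_mul (M.slope l))
    rw [mul_one, sub_self] at this
    exact this
  have := isOpen_Ioo.is_const_of_deriv_eq_zero isPreconnected_Ioo
    (fun y hy => (hd y hy).differentiableAt.differentiableWithinAt)
    (fun y hy => (hd y hy).deriv) hx hm
  simp only [intercept] at *
  linarith

theorem slope_ne_zero (l : Fin N) : M.slope l ≠ 0 := by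
  intro h
  have := M.expanding l
  simp [h] at this
  linarith

theorem continuous_invBranch (l : Fin N) : Continuous (M.invBranch l) := by
  unfold invBranch
  fun_prop

theorem differentiable_invBranch (l : Fin N) : Differentiable ℂ (M.invBranch l) := by
  unfold invBranch
  fun_prop

variable {M}

theorem AdaptedDisks.mapsTo_self (D : M.AdaptedDisks) (k l : Fin N)
    (h : M.transitionMatrix l k = 1) :
    Set.MapsTo (M.invBranch l) (Metric.ball D.c D.R) (Metric.ball D.c D.R) :=
  fun _ hz => Metric.ball_subset_ball D.r_lt_R.le (D.mapsTo k l h hz)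

/-- The operator `h ↦ h ∘ φ_{kl}` on `H^∞(D_R)`, for a pair with `A_{lk} = 1`. -/
def compBranch (D : M.AdaptedDisks) (k l : Fin N) (h : M.transitionMatrix l k = 1) :
    HInf D.c D.R →L[ℂ] HInf D.c D.R :=
  LinearMap.mkContinuous
    { toFun := fun g =>
        ⟨g.1.compContinuous ⟨(D.mapsTo_self k l h).restrict,
            (M.continuous_invBranch l).continuousOn.mapsToRestrict (D.mapsTo_self k l h)⟩, by
          obtain ⟨G, hG, e⟩ := g.2
          exact ⟨fun z => G (M.invBranch l z),
            hG.comp (M.differentiable_invBranch l).differentiableOn (D.mapsTo_self k l h),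
            fun z => e _⟩⟩
      map_add' := fun _ _ => rfl
      map_smul' := fun _ _ => rfl } 1 (by
    intro g
    rw [one_mul]
    exact (BoundedContinuousFunction.norm_le (norm_nonneg _)).2 fun z => g.1.norm_coe_le_norm _)

/-- The transfer operator `𝓛_β` on `𝓗(D_R)`,
`(𝓛_β h)_k(z) = ∑_l A_{lk} |γ_l|^{-β} h_l(φ_{kl}(z))`. -/
def transferOp (D : M.AdaptedDisks) (β : ℝ) :
    HSpace N D.c D.R →L[ℂ] HSpace N D.c D.R :=
  open Classical in
  ContinuousLinearMap.pi fun k => ∑ l,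
    if h : M.transitionMatrix l k = 1 then
      (((|M.slope l| ^ β)⁻¹ : ℝ) : ℂ) • (compBranch D k l h ∘L ContinuousLinearMap.proj l)
    else 0

theorem exists_transition (l : Fin N) : ∃ k, M.transitionMatrix l k = 1 := by
  by_contra! hne
  have hinj : Set.InjOn M.f (Set.Ioo (M.lo l) (M.hi l)) := by
    intro x hx y hy hxy
    rw [M.eq_affine l hx, M.eq_affine l hy] at hxy
    exact mul_left_cancel₀ (M.slope_ne_zero l) (add_right_cancel hxy)
  have hinf : (M.f '' Set.Ioo (M.lo l) (M.hi l)).Infinite :=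
    (Set.Ioo_infinite (M.lo_lt_hi l)).image hinj
  apply hinf
  apply ((Set.finite_range M.lo).union (Set.finite_range M.hi)).subset
  rintro _ ⟨x, hx, rfl⟩
  have hxI : M.f x ∈ Set.Icc M.a M.b := by
    apply M.mapsTo
    rw [← M.iUnion_eq]
    exact Set.mem_iUnion.2 ⟨l, Set.Ioo_subset_Icc_self hx⟩
  rw [← M.iUnion_eq] at hxI
  obtain ⟨k, hk⟩ := Set.mem_iUnion.1 hxI
  by_cases hk' : M.f x ∈ Set.Ioo (M.lo k) (M.hi k)
  · exfalso
    rcases M.markov l k with h | h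
    · exact Set.eq_empty_iff_forall_notMem.1 h _ ⟨⟨x, hx, rfl⟩, hk'⟩
    · exact hne k (by simp [transitionMatrix, h])
  · rcases eq_or_lt_of_le hk.1 with h | h
    · exact Or.inl ⟨k, h⟩
    · rcases eq_or_lt_of_le hk.2 with h' | h'
      · exact Or.inr ⟨k, h'.symm⟩
      · exact absurd ⟨h, h'⟩ hk'

theorem invBranch_f (l : Fin N) {y : ℝ} (hy : y ∈ Set.Ioo (M.lo l) (M.hi l)) :
    M.invBranch l (M.f y : ℝ) = y := by
  have := M.slope_ne_zero l
  rw [M.eq_affine l hy, invBranch]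
  push_cast
  have h' : (M.slope l : ℂ) ≠ 0 := by exact_mod_cast this
  field_simp
  ring

/-- The interval lies in the disk `D_R`. -/
theorem AdaptedDisks.interval_subset (D : M.AdaptedDisks) {x : ℝ} (hx : x ∈ Set.Icc M.a M.b) :
    (x : ℂ) ∈ Metric.ball D.c D.R := by
  obtain ⟨x₀, hx₀, hmax⟩ := isCompact_Icc.exists_isMaxOn (Set.nonempty_Icc.2 M.a_lt_b.le)
    (f := fun x : ℝ => ‖(x : ℂ) - D.c‖) (by fun_prop)
  rw [mem_ball_iff_norm]
  refine lt_of_le_of_lt (hmax hx) ?_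
  by_contra! hB
  set B := ‖(x₀ : ℂ) - D.c‖ with hBdef
  have hr := D.r_pos
  have hrR := D.r_lt_R
  set R' := (D.r + D.R) / 2 with hR'
  have hB0 : 0 < B := by linarith
  have key : ∀ l, ∀ y ∈ Set.Ioo (M.lo l) (M.hi l), ‖(y : ℂ) - D.c‖ ≤ D.r + (B - R') := by
    intro l y hy
    obtain ⟨k, hk⟩ := exists_transition (M := M) l
    have hyI : y ∈ Set.Icc M.a M.b := by
      rw [← M.iUnion_eq]
      exact Set.mem_iUnion.2 ⟨l, Set.Ioo_subset_Icc_self hy⟩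
    have hw : ‖((M.f y : ℝ) : ℂ) - D.c‖ ≤ B := hmax (M.mapsTo hyI)
    set w : ℂ := ((M.f y : ℝ) : ℂ) with hwdef
    have hyw : M.invBranch l w = y := invBranch_f l hy
    set z : ℂ := D.c + ((R' / B : ℝ) : ℂ) * (w - D.c) with hz
    have hR'0 : 0 ≤ R' / B := div_nonneg (by linarith) hB0.le
    have hzb : z ∈ Metric.ball D.c D.R := by
      rw [mem_ball_iff_norm, hz, add_sub_cancel_left, norm_mul, Complex.norm_real,
        Real.norm_of_nonneg hR'0]
      calc R' / B * ‖w - D.c‖ ≤ R' / B * B := by gcongr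
        _ = R' := by field_simp
        _ < D.R := by linarith
    have h1 := D.mapsTo k l hk hzb
    rw [mem_ball_iff_norm] at h1
    have hzw : ‖w - z‖ ≤ B - R' := by
      have : w - z = ((1 - R' / B : ℝ) : ℂ) * (w - D.c) := by
        rw [hz]; push_cast; ring
      have hle : R' / B ≤ 1 := by rw [div_le_one hB0]; linarith
      rw [this, norm_mul, Complex.norm_real, Real.norm_of_nonneg (by linarith)]
      calc (1 - R' / B) * ‖w - D.c‖ ≤ (1 - R' / B) * B := by
            apply mul_le_mul_of_nonneg_left hw; linarith
        _ = B - R' := by field_simp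
    have h2 : ‖(y : ℂ) - M.invBranch l z‖ ≤ B - R' := by
      have : (y : ℂ) - M.invBranch l z = (w - z) / M.slope l := by
        rw [← hyw]; simp only [invBranch]; ring
      rw [this, norm_div, Complex.norm_real]
      have he := M.expanding l
      refine le_trans (div_le_self (norm_nonneg _) ?_) hzw
      rw [Real.norm_eq_abs]; exact he.le
    calc ‖(y : ℂ) - D.c‖ = ‖(M.invBranch l z - D.c) + ((y : ℂ) - M.invBranch l z)‖ := by ring_nf
      _ ≤ _ := norm_add_le _ _
      _ ≤ _ := by linarith
  rw [← M.iUnion_eq] at hx₀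
  obtain ⟨l, hl⟩ := Set.mem_iUnion.1 hx₀
  rw [← closure_Ioo (M.lo_lt_hi l).ne] at hl
  have hcl : IsClosed {y : ℝ | ‖(y : ℂ) - D.c‖ ≤ D.r + (B - R')} :=
    isClosed_le (by fun_prop) continuous_const
  have h3 : ‖(x₀ : ℂ) - D.c‖ ≤ D.r + (B - R') := closure_minimal (key l) hcl hl
  rw [← hBdef] at h3
  linarith

/-- On the partition intervals `𝓛_β` is the sum over preimages
`(𝓛_β h)(x) = ∑_{y ∈ f⁻¹(x)} h(y) / |f'(y)|^β`. -/
theorem transferOp_eval (D : M.AdaptedDisks) (β : ℝ) (h : HSpace N D.c D.R) (k : Fin N) {x : ℝ}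
    (hx : x ∈ Set.Ioo (M.lo k) (M.hi k)) :
    HInf.eval (transferOp D β h k) x =
      ∑ l, ∑ᶠ y ∈ {y : ℝ | y ∈ Set.Ioo (M.lo l) (M.hi l) ∧ M.f y = x},
        HInf.eval (h l) y / ((|deriv M.f y| ^ β : ℝ) : ℂ) := by
  classical
  have hxI : x ∈ Set.Icc M.a M.b := by
    rw [← M.iUnion_eq]
    exact Set.mem_iUnion.2 ⟨k, Set.Ioo_subset_Icc_self hx⟩
  have hxD := D.interval_subset hxI
  have e1 : HInf.eval (transferOp D β h k) x = ∑ l, if hA : M.transitionMatrix l k = 1 then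
      (((|M.slope l| ^ β)⁻¹ : ℝ) : ℂ) * (h l).1 ⟨M.invBranch l x, D.mapsTo_self k l hA hxD⟩
      else 0 := by
    rw [HInf.eval, dif_pos hxD]
    simp only [transferOp, ContinuousLinearMap.coe_pi', sum_apply]
    rw [Submodule.coe_sum, BoundedContinuousFunction.coe_sum, Finset.sum_apply]
    refine Finset.sum_congr rfl fun l _ => ?_
    split_ifs with hA
    · rfl
    · rfl
  rw [e1]
  refine Finset.sum_congr rfl fun l _ => ?_
  by_cases hsub : Set.Ioo (M.lo k) (M.hi k) ⊆ M.f '' Set.Ioo (M.lo l) (M.hi l)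
  · have hA : M.transitionMatrix l k = 1 := by simp [transitionMatrix, hsub]
    obtain ⟨y, hy, hyx⟩ := hsub hx
    have hset : {y : ℝ | y ∈ Set.Ioo (M.lo l) (M.hi l) ∧ M.f y = x} = {y} := by
      ext y'
      simp only [Set.mem_ofPred_eq, Set.mem_singleton_iff]
      constructor
      · rintro ⟨hy', e⟩
        have a1 := invBranch_f (M := M) l hy'
        have a2 := invBranch_f (M := M) l hy
        rw [e] at a1
        rw [hyx, a1] at a2
        exact_mod_cast a2
      · rintro rfl
        exact ⟨hy, hyx⟩
    have hφ : M.invBranch l x = y := by rw [← hyx]; exact invBranch_f l hy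
    have hyD : (y : ℂ) ∈ Metric.ball D.c D.R := hφ ▸ D.mapsTo_self k l hA hxD
    rw [dif_pos hA, hset, finsum_mem_singleton, (M.hasDerivAt l y hy).deriv, HInf.eval,
      dif_pos hyD]
    have : (⟨M.invBranch l x, D.mapsTo_self k l hA hxD⟩ : Metric.ball D.c D.R) = ⟨y, hyD⟩ :=
      Subtype.ext hφ
    rw [this]
    push_cast
    rw [div_eq_mul_inv, mul_comm]
  · have hA : ¬ M.transitionMatrix l k = 1 := by simp [transitionMatrix, hsub]
    have hemp : M.f '' Set.Ioo (M.lo l) (M.hi l) ∩ Set.Ioo (M.lo k) (M.hi k) = ∅ :=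
      (M.markov l k).resolve_right hsub
    have hset : {y : ℝ | y ∈ Set.Ioo (M.lo l) (M.hi l) ∧ M.f y = x} = ∅ := by
      ext y'
      simp only [Set.mem_ofPred_eq, Set.mem_empty_iff_false, iff_false]
      rintro ⟨hy', e⟩
      exact Set.eq_empty_iff_forall_notMem.1 hemp x ⟨⟨y', hy', e⟩, hx⟩
    rw [dif_neg hA, hset, finsum_mem_empty]

end PLExpandingMarkovMap

/-- `ν` is a simple positive leading eigenvalue of the bounded operator `L`: it is positive, an
eigenvalue of algebraic multiplicity one, and strictly larger than the modulus of every other point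
of the spectrum of `L`. -/
structure IsSimplePositiveLeadingEigenvalue {E : Type*} [NormedAddCommGroup E] [NormedSpace ℂ E]
    (L : E →L[ℂ] E) (ν : ℝ) : Prop where
  pos : 0 < ν
  hasEigenvalue : Module.End.HasEigenvalue (L : Module.End ℂ E) (ν : ℂ)
  simple : Module.finrank ℂ (Module.End.maxGenEigenspace (L : Module.End ℂ E) (ν : ℂ)) = 1
  leading : ∀ μ ∈ spectrum ℂ L, μ ≠ (ν : ℂ) → ‖μ‖ < ν

/-- `ν` is the Perron eigenvalue of the real square matrix `T`: it is positive, a simple root of the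
characteristic polynomial, and strictly larger than the modulus of every other complex
eigenvalue. -/
structure IsPerronEigenvalue {n : Type*} [Fintype n] [DecidableEq n]
    (T : Matrix n n ℝ) (ν : ℝ) : Prop where
  pos : 0 < ν
  simple : T.charpoly.rootMultiplicity ν = 1
  leading : ∀ μ ∈ spectrum ℂ (T.map (algebraMap ℝ ℂ)), μ ≠ (ν : ℂ) → ‖μ‖ < ν

end MarkovTransfer

end

/-!
The constant tuples form a copy of `ℂ ^ N` inside `𝓗(D_R)` that is invariant under `𝓛_β`, and on it
`𝓛_β` acts as the matrix `T^{(00)}(β)` (`transferOp_constMap`). Topological mixing makes this matrix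
primitive, so by the Perron–Frobenius theorem it has a simple dominant eigenvalue `ν > 0` with
positive right and left eigenvectors `x` and `u` (`exists_pos_left_right_eigenvector`,
`isPerronEigenvalue_of_isPrimitive`).

Modulo constants `𝓛_β` is smaller. The inverse branches contract by the factor `C = 1 / inf |γ_l| < 1`,
so `𝓛_β` multiplies Lipschitz constants on the disk, measured in component `k` relative to `x k`, by
`C ν`. By Cauchy's estimate a bounded holomorphic function on `D_R` is Lipschitz on `D_r`; hence the
oscillation of `𝓛_β ^ n h` is `O((C ν) ^ n ‖h‖)` (`exists_norm_transferOp_pow_le`), and the compression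
of `𝓛_β` to the functions vanishing at the centre has spectrum in the disk of radius `C ν < ν`. As
`𝓛_β` is block triangular, outside that disk its spectrum and its generalized eigenspaces are those of
`T^{(00)}(β)` (`mem_spectrum_restriction_of_mem_spectrum`, `maxGenEigenspace_eq_map`). Neither
compactness of `𝓛_β` nor the higher Taylor coefficients are needed.

The entries of `T^{(mm)}(β)`, `m ≥ 1`, are bounded in modulus by `C` times those of `T^{(00)}(β)`, and
pairing with `u` turns this into the bound on the spectral radius
(`spectralRadius_map_le_of_abs_le`).
-/

noncomputable section

namespace MarkovTransfer

open Matrix PLExpandingMarkovMap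

/-! ### Perron–Frobenius theory of primitive matrices -/

section Perron

variable {n : Type*} [Fintype n] {T : Matrix n n ℝ} {ν : ℝ} {u : n → ℝ}

theorem mulVec_pos_of_entries_pos {P : Matrix n n ℝ} (hP : ∀ i j, 0 < P i j) {v : n → ℝ}
    (hv : ∀ i, 0 ≤ v i) (hv0 : v ≠ 0) (i : n) : 0 < (P *ᵥ v) i := by
  obtain ⟨j, hj⟩ := Function.ne_iff.1 hv0
  have hj' : 0 < v j := lt_of_le_of_ne (hv j) (Ne.symm hj)
  exact Finset.sum_pos' (fun k _ => mul_nonneg (hP i k).le (hv k))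
    ⟨j, Finset.mem_univ j, mul_pos (hP i j) hj'⟩

theorem exists_pos_mul_le [Nonempty n] {y z : n → ℝ} (hy : ∀ i, 0 < y i) (hz : ∀ i, 0 < z i) :
    ∃ ε > 0, ∀ i, ε * y i ≤ z i := by
  obtain ⟨i₀, h⟩ := Finite.exists_min fun i => z i / y i
  exact ⟨z i₀ / y i₀, div_pos (hz _) (hy _), fun i => (le_div_iff₀ (hy i)).1 (h i)⟩

theorem ofReal_dotProduct_mulVec (hTu : u ᵥ* T = ν • u) (y : n → ℂ) :
    (fun i => (u i : ℂ)) ⬝ᵥ (T.map (algebraMap ℝ ℂ) *ᵥ y) = ν * ((fun i => (u i : ℂ)) ⬝ᵥ y) := by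
  have h : (fun i => (u i : ℂ)) ᵥ* T.map (algebraMap ℝ ℂ) = (ν : ℂ) • fun i => (u i : ℂ) := by
    ext j
    have := congrArg (fun t : ℝ => (t : ℂ)) (congrFun hTu j)
    simpa [vecMul, dotProduct] using this
  rw [dotProduct_mulVec, h, smul_dotProduct, smul_eq_mul]

variable [DecidableEq n]

theorem pow_mulVec_of_mulVec_eq_smul {R : Type*} [CommRing R] {T : Matrix n n R} {x : n → R} {ν : R}
    (h : T *ᵥ x = ν • x) (p : ℕ) : (T ^ p) *ᵥ x = ν ^ p • x := by
  induction p with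
  | zero => simp
  | succ p ih => rw [pow_succ, ← mulVec_mulVec, h, mulVec_smul, ih, smul_smul, pow_succ, mul_comm]

/-- A primitive matrix has a positive eigenvector with positive eigenvalue: the largest `t` for which
`t x ≤ T x` has a solution `x` in the standard simplex is an eigenvalue, since otherwise replacing
`x` by `T ^ p x` would allow a larger `t`. -/
theorem exists_pos_eigenvector [Nonempty n] (hT : T.IsPrimitive) :
    ∃ ν : ℝ, 0 < ν ∧ ∃ x : n → ℝ, (∀ i, 0 < x i) ∧ T *ᵥ x = ν • x := by
  obtain ⟨p, hp, hpos⟩ := hT.2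
  have hnn := hT.nonneg
  set S : Set ((n → ℝ) × ℝ) :=
    {q | q.1 ∈ stdSimplex ℝ n ∧ 0 ≤ q.2 ∧ ∀ i, q.2 * q.1 i ≤ (T *ᵥ q.1) i} with hS
  have hScl : IsClosed S := by
    have hSeq : S = Prod.fst ⁻¹' stdSimplex ℝ n ∩ ({q | 0 ≤ q.2} ∩
        ⋂ i, {q | q.2 * q.1 i ≤ (T *ᵥ q.1) i}) := by
      ext q
      simp [hS]
    rw [hSeq]
    refine ((isClosed_stdSimplex ℝ n).preimage continuous_fst).inter
      ((isClosed_le continuous_const continuous_snd).inter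
        (isClosed_iInter fun i => isClosed_le (by fun_prop) ?_))
    exact (continuous_apply i).comp (Continuous.matrix_mulVec continuous_const continuous_fst)
  have hSc : IsCompact S := by
    refine ((isCompact_stdSimplex ℝ n).prod
      (isCompact_Icc (a := 0) (b := ∑ i, ∑ j, T i j))).of_isClosed_subset hScl ?_
    rintro ⟨x, t⟩ ⟨hx, ht, hle⟩
    refine ⟨hx, ht, ?_⟩
    calc t = ∑ i, t * x i := by rw [← Finset.mul_sum, hx.2, mul_one]
      _ ≤ ∑ i, (T *ᵥ x) i := Finset.sum_le_sum fun i _ => hle i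
      _ ≤ ∑ i, ∑ j, T i j := by
        refine Finset.sum_le_sum fun i _ => Finset.sum_le_sum fun j _ => ?_
        refine mul_le_of_le_one_right (hnn i j) ?_
        rw [← hx.2]
        exact Finset.single_le_sum (fun k _ => hx.1 k) (Finset.mem_univ j)
  have hSne : S.Nonempty := by
    obtain ⟨i⟩ := ‹Nonempty n›
    refine ⟨(Pi.single i 1, 0), single_mem_stdSimplex ℝ i, le_rfl, fun k => ?_⟩
    rw [zero_mul]
    exact Finset.sum_nonneg fun j _ => mul_nonneg (hnn k j) ((single_mem_stdSimplex ℝ i).1 j)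
  obtain ⟨⟨x, ν⟩, ⟨hx, hν, hle⟩, hmax⟩ := hSc.exists_isMaxOn hSne continuous_snd.continuousOn
  simp only at hx hν hle
  -- The maximum of `t` over the compact set `S` is attained at `(x, ν)`.
  have hx0 : x ≠ 0 := by
    rintro rfl
    simpa using hx.2
  have hypos := mulVec_pos_of_entries_pos hpos hx.1 hx0
  have heq : T *ᵥ x = ν • x := by
    by_contra hne
    have hzpos := mulVec_pos_of_entries_pos hpos (v := T *ᵥ x - ν • x)
      (fun i => by simpa using hle i) (sub_ne_zero.2 hne)
    obtain ⟨ε, hε, hεle⟩ := exists_pos_mul_le hypos hzpos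
    set y := (T ^ p) *ᵥ x with hy
    have hz : (T ^ p) *ᵥ (T *ᵥ x - ν • x) = T *ᵥ y - ν • y := by
      rw [mulVec_sub, mulVec_smul, hy, mulVec_mulVec, mulVec_mulVec, pow_mul_comm']
    rw [hz] at hεle
    have hs : 0 < ∑ i, y i := Finset.sum_pos (fun i _ => hypos i) Finset.univ_nonempty
    -- The normalization of `y` admits the larger value `ν + ε`.
    have hmem : ((∑ i, y i)⁻¹ • y, ν + ε) ∈ S := by
      refine ⟨⟨fun i => mul_nonneg (inv_nonneg.2 hs.le) (hypos i).le, ?_⟩, by simp only; linarith,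
        fun i => ?_⟩
      · simp only [Pi.smul_apply, smul_eq_mul]
        rw [← Finset.mul_sum, inv_mul_cancel₀ hs.ne']
      · have h1 := hεle i
        simp only [Pi.sub_apply, Pi.smul_apply, smul_eq_mul, mulVec_smul] at h1 ⊢
        have h2 := inv_pos.2 hs
        calc (ν + ε) * ((∑ i, y i)⁻¹ * y i) = (∑ i, y i)⁻¹ * ((ν + ε) * y i) := by ring
          _ ≤ _ := by
            apply mul_le_mul_of_nonneg_left _ h2.le
            linarith
    have h3 : ν + ε ≤ ν := hmax hmem
    linarith
  have hpow : ∀ i, 0 < ν ^ p * x i := fun i => by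
    have := hypos i
    rw [pow_mulVec_of_mulVec_eq_smul heq p] at this
    simpa using this
  refine ⟨ν, lt_of_le_of_ne hν ?_, x, fun i => pos_of_mul_pos_right (hpow i) (pow_nonneg hν p), heq⟩
  rintro rfl
  obtain ⟨i⟩ := ‹Nonempty n›
  simpa [hp.ne'] using hpow i

/-- A primitive matrix has positive right and left eigenvectors for a common positive
eigenvalue. -/
theorem exists_pos_left_right_eigenvector [Nonempty n] (hT : T.IsPrimitive) :
    ∃ ν : ℝ, 0 < ν ∧ ∃ x u : n → ℝ, (∀ i, 0 < x i) ∧ (∀ i, 0 < u i) ∧ T *ᵥ x = ν • x ∧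
      u ᵥ* T = ν • u := by
  obtain ⟨ν, hν, x, hx, hTx⟩ := exists_pos_eigenvector hT
  have hT' : Tᵀ.IsPrimitive := by
    obtain ⟨p, hp, hpos⟩ := hT.2
    exact ⟨fun i j => hT.nonneg j i, p, hp, fun i j => by
      rw [← transpose_pow]; exact hpos j i⟩
  obtain ⟨ν', _, u, hu, hTu⟩ := exists_pos_eigenvector hT'
  rw [mulVec_transpose] at hTu
  have hux : 0 < u ⬝ᵥ x :=
    Finset.sum_pos (fun i _ => mul_pos (hu i) (hx i)) Finset.univ_nonempty
  have h := dotProduct_mulVec u T x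
  rw [hTx, hTu, dotProduct_smul, smul_dotProduct, smul_eq_mul, smul_eq_mul] at h
  have : ν = ν' := mul_right_cancel₀ hux.ne' h
  subst this
  exact ⟨ν, hν, x, u, hx, hu, hTx, hTu⟩

/-- On the kernel of the positive left eigenvector `u`, all eigenvalues of a primitive matrix are
smaller than the Perron eigenvalue. For `δ` small, `T ^ p - δ 1 uᵀ` has nonnegative entries and
agrees with `T ^ p` on that kernel, so `T ^ p` contracts the `u`-weighted `ℓ¹` norm there by the
factor `ν ^ p - δ ∑ u < ν ^ p`. -/
theorem norm_lt_of_dotProduct_eq_zero [Nonempty n] (hT : T.IsPrimitive) (hν : 0 < ν)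
    (hu : ∀ i, 0 < u i) (hTu : u ᵥ* T = ν • u) {y : n → ℂ} (hy : y ≠ 0)
    (huy : (fun i => (u i : ℂ)) ⬝ᵥ y = 0) {μ : ℂ}
    (hTy : T.map (algebraMap ℝ ℂ) *ᵥ y = μ • y) : ‖μ‖ < ν := by
  obtain ⟨p, hp, hpos⟩ := hT.2
  obtain ⟨δ, hδ, hδle⟩ : ∃ δ > 0, ∀ q : n × n, δ * u q.2 ≤ (T ^ p) q.1 q.2 :=
    exists_pos_mul_le (y := fun q : n × n => u q.2) (z := fun q => (T ^ p) q.1 q.2)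
      (fun q => hu _) (fun q => hpos _ _)
  have hpow : (T.map (algebraMap ℝ ℂ)) ^ p = (T ^ p).map (algebraMap ℝ ℂ) :=
    (Matrix.map_pow T (algebraMap ℝ ℂ) p).symm
  have hrow : ∀ i, ‖μ‖ ^ p * ‖y i‖ ≤ ∑ j, ((T ^ p) i j - δ * u j) * ‖y j‖ := by
    intro i
    have h1 := congrFun (pow_mulVec_of_mulVec_eq_smul hTy p) i
    rw [hpow] at h1
    have h2 : μ ^ p * y i = ∑ j, (((T ^ p) i j - δ * u j : ℝ) : ℂ) * y j := by
      rw [← smul_eq_mul, ← Pi.smul_apply, ← h1]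
      simp only [Complex.ofReal_sub, Complex.ofReal_mul, sub_mul, Finset.sum_sub_distrib, mul_assoc,
        ← Finset.mul_sum]
      -- The rank-one correction vanishes since `u · y = 0`.
      rw [show ∑ j, (u j : ℂ) * y j = 0 from huy, mul_zero, sub_zero]
      rfl
    rw [← norm_pow, ← norm_mul, h2]
    refine (norm_sum_le _ _).trans_eq (Finset.sum_congr rfl fun j _ => ?_)
    rw [norm_mul, Complex.norm_real, Real.norm_of_nonneg (sub_nonneg.2 (hδle (i, j)))]
  have hTup : ∀ j, ∑ i, u i * (T ^ p) i j = ν ^ p * u j := by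
    rw [← mulVec_transpose] at hTu
    intro j
    have := congrFun (pow_mulVec_of_mulVec_eq_smul hTu p) j
    rw [← transpose_pow, mulVec_transpose] at this
    simpa [vecMul, dotProduct] using this
  have hw : 0 < ∑ i, u i * ‖y i‖ := by
    obtain ⟨j, hj⟩ := Function.ne_iff.1 hy
    exact Finset.sum_pos' (fun k _ => mul_nonneg (hu k).le (norm_nonneg _))
      ⟨j, Finset.mem_univ j, mul_pos (hu j) (norm_pos_iff.2 hj)⟩
  have hus : 0 < ∑ i, u i := Finset.sum_pos (fun i _ => hu i) Finset.univ_nonempty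
  have key : ‖μ‖ ^ p * ∑ i, u i * ‖y i‖ ≤ (ν ^ p - δ * ∑ i, u i) * ∑ i, u i * ‖y i‖ := by
    calc ‖μ‖ ^ p * ∑ i, u i * ‖y i‖ = ∑ i, u i * (‖μ‖ ^ p * ‖y i‖) := by
          rw [Finset.mul_sum]; exact Finset.sum_congr rfl fun i _ => by ring
      _ ≤ ∑ i, u i * ∑ j, ((T ^ p) i j - δ * u j) * ‖y j‖ :=
          Finset.sum_le_sum fun i _ => mul_le_mul_of_nonneg_left (hrow i) (hu i).le
      _ = ∑ j, (∑ i, u i * ((T ^ p) i j - δ * u j)) * ‖y j‖ := by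
          simp only [Finset.mul_sum, Finset.sum_mul]
          rw [Finset.sum_comm]
          exact Finset.sum_congr rfl fun i _ => Finset.sum_congr rfl fun j _ => by ring
      _ = ∑ j, (ν ^ p - δ * ∑ i, u i) * (u j * ‖y j‖) := by
          refine Finset.sum_congr rfl fun j _ => ?_
          simp only [mul_sub, Finset.sum_sub_distrib, hTup, ← Finset.sum_mul]
          ring
      _ = _ := by rw [← Finset.mul_sum]
  have h4 := le_of_mul_le_mul_right key hw
  refine lt_of_pow_lt_pow_left₀ p hν.le (h4.trans_lt ?_)
  have := mul_pos hδ hus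
  linarith

/-- Every eigenvalue of a primitive matrix other than the Perron eigenvalue has smaller modulus:
its eigenvectors are annihilated by the left Perron eigenvector. -/
theorem norm_lt_of_mem_spectrum_map [Nonempty n] (hT : T.IsPrimitive) (hν : 0 < ν)
    (hu : ∀ i, 0 < u i) (hTu : u ᵥ* T = ν • u) {μ : ℂ}
    (hμ : μ ∈ spectrum ℂ (T.map (algebraMap ℝ ℂ))) (hne : μ ≠ ν) : ‖μ‖ < ν := by
  rw [← spectrum_toLin', ← Module.End.hasEigenvalue_iff_mem_spectrum] at hμ
  obtain ⟨y, hy⟩ := hμ.exists_hasEigenvector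
  have hTy : T.map (algebraMap ℝ ℂ) *ᵥ y = μ • y := by simpa using hy.apply_eq_smul
  refine norm_lt_of_dotProduct_eq_zero hT hν hu hTu hy.2 ?_ hTy
  have h := ofReal_dotProduct_mulVec hTu y
  rw [hTy, dotProduct_smul, smul_eq_mul] at h
  by_contra h0
  exact hne (mul_right_cancel₀ h0 h)

/-- The Perron eigenvalue is algebraically simple: `T - ν` preserves the kernel of the left Perron
eigenvector `u` and is injective on it, and this kernel is a complement of the line through `x`. -/
theorem maxGenEigenspace_toLin'_eq_span [Nonempty n] (hT : T.IsPrimitive) (hν : 0 < ν)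
    (hu : ∀ i, 0 < u i) (hTu : u ᵥ* T = ν • u) {x : n → ℝ} (hx : ∀ i, 0 < x i)
    (hTx : T *ᵥ x = ν • x) :
    Module.End.maxGenEigenspace (toLin' (T.map (algebraMap ℝ ℂ))) (ν : ℂ) =
      Submodule.span ℂ {fun i => (x i : ℂ)} := by
  set U : n → ℂ := fun i => (u i : ℂ) with hU
  set X : n → ℂ := fun i => (x i : ℂ) with hX
  set F : Module.End ℂ (n → ℂ) := toLin' (T.map (algebraMap ℝ ℂ)) - (ν : ℂ) • 1 with hF
  have hFapp : ∀ w, F w = T.map (algebraMap ℝ ℂ) *ᵥ w - (ν : ℂ) • w := fun w => by simp [hF]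
  have hFX : F X = 0 := by
    rw [hFapp, sub_eq_zero]
    ext i
    have := congrArg (fun t : ℝ => (t : ℂ)) (congrFun hTx i)
    simpa [mulVec, dotProduct] using this
  have hFU : ∀ w, U ⬝ᵥ F w = 0 := fun w => by
    rw [hFapp, dotProduct_sub, ofReal_dotProduct_mulVec hTu, dotProduct_smul, smul_eq_mul, sub_self]
  have hker : ∀ (k : ℕ) (w : n → ℂ), U ⬝ᵥ w = 0 → (F ^ k) w = 0 → w = 0 := by
    intro k
    induction k with
    | zero => exact fun w _ h => by simpa using h
    | succ k ih =>
      intro w hw h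
      have h1 : F w = 0 := ih (F w) (hFU w) (by rw [pow_succ] at h; exact h)
      by_contra hw0
      rw [hFapp, sub_eq_zero] at h1
      have := norm_lt_of_dotProduct_eq_zero hT hν hu hTu hw0 hw h1
      rw [Complex.norm_real, Real.norm_of_nonneg hν.le] at this
      exact lt_irrefl _ this
  have hUX : U ⬝ᵥ X ≠ 0 := by
    have : U ⬝ᵥ X = ((∑ i, u i * x i : ℝ) : ℂ) := by simp [hU, hX, dotProduct]
    rw [this, Complex.ofReal_ne_zero]
    exact (Finset.sum_pos (fun i _ => mul_pos (hu i) (hx i)) Finset.univ_nonempty).ne'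
  apply le_antisymm
  · intro w hw
    obtain ⟨k, hk⟩ := (Module.End.mem_maxGenEigenspace _ _ _).1 hw
    have hw1 := hker (k + 1) (w - (U ⬝ᵥ w / U ⬝ᵥ X) • X)
      (by rw [dotProduct_sub, dotProduct_smul, smul_eq_mul, div_mul_cancel₀ _ hUX, sub_self])
      (by
        rw [map_sub, map_smul, pow_succ, Module.End.mul_apply, Module.End.mul_apply, hFX,
          ← Module.End.mul_apply, ← pow_succ, pow_succ', Module.End.mul_apply, hk]
        simp)
    rw [sub_eq_zero] at hw1
    rw [hw1]
    exact Submodule.smul_mem _ _ (Submodule.mem_span_singleton_self X)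
  · rw [Submodule.span_singleton_le_iff_mem, Module.End.mem_maxGenEigenspace]
    exact ⟨1, by rw [pow_one]; exact hFX⟩

theorem finrank_maxGenEigenspace_toLin'_eq_one [Nonempty n] (hT : T.IsPrimitive) (hν : 0 < ν)
    (hu : ∀ i, 0 < u i) (hTu : u ᵥ* T = ν • u) {x : n → ℝ} (hx : ∀ i, 0 < x i)
    (hTx : T *ᵥ x = ν • x) :
    Module.finrank ℂ (Module.End.maxGenEigenspace (toLin' (T.map (algebraMap ℝ ℂ))) (ν : ℂ)) =
      1 := by
  rw [maxGenEigenspace_toLin'_eq_span hT hν hu hTu hx hTx]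
  refine finrank_span_singleton fun h => ?_
  obtain ⟨i⟩ := ‹Nonempty n›
  exact (hx i).ne' (by simpa using congrFun h i)

theorem isPerronEigenvalue_of_isPrimitive [Nonempty n] (hT : T.IsPrimitive) (hν : 0 < ν)
    (hu : ∀ i, 0 < u i) (hTu : u ᵥ* T = ν • u) {x : n → ℝ} (hx : ∀ i, 0 < x i)
    (hTx : T *ᵥ x = ν • x) : IsPerronEigenvalue T ν where
  pos := hν
  simple := by
    have h := finrank_maxGenEigenspace_toLin'_eq_one hT hν hu hTu hx hTx
    rw [LinearMap.finrank_maxGenEigenspace_eq, charpoly_toLin', charpoly_map] at h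
    rw [Polynomial.eq_rootMultiplicity_map (algebraMap ℝ ℂ).injective]
    exact h
  leading := fun _ hμ hne => norm_lt_of_mem_spectrum_map hT hν hu hTu hμ hne

/-- For an eigenvector `y` of `S` with eigenvalue `μ` one has `|μ| |y| ≤ C T |y|`; pairing with the
positive left eigenvector `u` of `T` gives `|μ| ≤ C ν`. -/
theorem spectralRadius_map_le_of_abs_le {S : Matrix n n ℝ} {C : ℝ}
    (hST : ∀ i j, |S i j| ≤ C * T i j) (hu : ∀ i, 0 < u i) (hTu : u ᵥ* T = ν • u) :
    spectralRadius ℂ (S.map (algebraMap ℝ ℂ)) ≤ ENNReal.ofReal (C * ν) := by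
  refine iSup₂_le fun μ hμ => ?_
  rw [← spectrum_toLin', ← Module.End.hasEigenvalue_iff_mem_spectrum] at hμ
  obtain ⟨y, hy⟩ := hμ.exists_hasEigenvector
  have hSy : S.map (algebraMap ℝ ℂ) *ᵥ y = μ • y := by simpa using hy.apply_eq_smul
  have hrow : ∀ i, ‖μ‖ * ‖y i‖ ≤ ∑ j, C * T i j * ‖y j‖ := by
    intro i
    have h1 : ∑ j, (S i j : ℂ) * y j = μ * y i := congrFun hSy i
    rw [← norm_mul, ← h1]
    refine (norm_sum_le _ _).trans (Finset.sum_le_sum fun j _ => ?_)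
    rw [norm_mul, Complex.norm_real]
    exact mul_le_mul_of_nonneg_right (hST i j) (norm_nonneg _)
  have hw : 0 < ∑ i, u i * ‖y i‖ := by
    obtain ⟨j, hj⟩ := Function.ne_iff.1 hy.2
    exact Finset.sum_pos' (fun k _ => mul_nonneg (hu k).le (norm_nonneg _))
      ⟨j, Finset.mem_univ j, mul_pos (hu j) (norm_pos_iff.2 hj)⟩
  have hTu' : ∀ j, ∑ i, u i * T i j = ν * u j := fun j => congrFun hTu j
  have key : ‖μ‖ * ∑ i, u i * ‖y i‖ ≤ (C * ν) * ∑ i, u i * ‖y i‖ := by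
    calc ‖μ‖ * ∑ i, u i * ‖y i‖ = ∑ i, u i * (‖μ‖ * ‖y i‖) := by
          rw [Finset.mul_sum]; exact Finset.sum_congr rfl fun i _ => by ring
      _ ≤ ∑ i, u i * ∑ j, C * T i j * ‖y j‖ :=
          Finset.sum_le_sum fun i _ => mul_le_mul_of_nonneg_left (hrow i) (hu i).le
      _ = ∑ j, C * (∑ i, u i * T i j) * ‖y j‖ := by
          simp only [Finset.mul_sum, Finset.sum_mul]
          rw [Finset.sum_comm]
          exact Finset.sum_congr rfl fun i _ => Finset.sum_congr rfl fun j _ => by ring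
      _ = _ := by
          rw [Finset.mul_sum]
          exact Finset.sum_congr rfl fun j _ => by rw [hTu']; ring
  have h := le_of_mul_le_mul_right key hw
  rw [← enorm_eq_nnnorm, ← ofReal_norm]
  exact ENNReal.ofReal_le_ofReal h

end Perron

/-! ### Spectrum of a block triangular operator -/

section BlockTriangular

theorem hasEigenvalue_of_finrank_maxGenEigenspace_ne_zero {𝕜 W : Type*} [Field 𝕜] [AddCommGroup W]
    [Module 𝕜 W] {f : Module.End 𝕜 W} {μ : 𝕜}
    (h : Module.finrank 𝕜 (f.maxGenEigenspace μ) ≠ 0) : f.HasEigenvalue μ := by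
  refine Module.End.HasUnifEigenvalue.lt (k := ⊤) one_pos fun hbot => h ?_
  rw [Module.End.maxGenEigenspace, hbot, finrank_bot]

variable {E V : Type*} [NormedAddCommGroup E] [NormedSpace ℂ E]
  [NormedAddCommGroup V] [NormedSpace ℂ V]
  {L : E →L[ℂ] E} {ι : V →L[ℂ] E} {π : E →L[ℂ] V} {T : Module.End ℂ V} {K ρ : ℝ}

/-- If `(1 - ιπ) L ^ (n + 1)` decays like `ρ ^ n`, then the compression `(1 - ιπ) L` of `L` to the
complement of the invariant subspace `ι V` has its spectrum in the closed disk of radius `ρ`. -/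
theorem notMem_spectrum_compression [CompleteSpace E] (hπι : ∀ v, π (ι v) = v)
    (hLι : ∀ v, L (ι v) = ι (T v)) (hρ : 0 < ρ)
    (hbound : ∀ n : ℕ, ‖(1 - ι ∘L π) * L ^ (n + 1)‖ ≤ K * ρ ^ n) {μ : ℂ} (hμ : ρ < ‖μ‖) :
    μ ∉ spectrum ℂ ((1 - ι ∘L π) * L) := by
  intro hmem
  have hpow : ∀ n : ℕ, ((1 - ι ∘L π) * L) ^ (n + 1) = (1 - ι ∘L π) * L ^ (n + 1) := by
    intro n
    have hQLQ : (1 - ι ∘L π) * L * (1 - ι ∘L π) = (1 - ι ∘L π) * L := by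
      ext h
      simp [hLι, hπι]
    induction n with
    | zero => simp
    | succ n ih => rw [pow_succ', ih, ← mul_assoc, hQLQ, mul_assoc, ← pow_succ']
  have hle : ∀ n : ℕ, (‖μ‖ / ρ) ^ n * ‖μ‖ ≤ K * ‖(1 : E →L[ℂ] E)‖ := by
    intro n
    have h1 := spectrum.norm_le_norm_mul_of_mem (spectrum.pow_mem_pow _ (n + 1) hmem)
    rw [hpow, norm_pow] at h1
    have h2 := h1.trans (mul_le_mul_of_nonneg_right (hbound n) (norm_nonneg _))
    rw [div_pow, div_mul_eq_mul_div, div_le_iff₀ (pow_pos hρ n), ← pow_succ]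
    linarith
  have h1 : 1 < ‖μ‖ / ρ := (one_lt_div hρ).2 hμ
  obtain ⟨n, hn⟩ := pow_unbounded_of_one_lt (K * ‖(1 : E →L[ℂ] E)‖ / ‖μ‖) h1
  rw [div_lt_iff₀ (hρ.trans hμ)] at hn
  exact (hle n).not_gt hn

/-- Outside the disk of radius `ρ`, the spectrum of the block triangular operator `L` is that of its
restriction `T` to the invariant subspace `ι V`. -/
theorem mem_spectrum_restriction_of_mem_spectrum [CompleteSpace E] (hπι : ∀ v, π (ι v) = v)
    (hLι : ∀ v, L (ι v) = ι (T v)) (hρ : 0 < ρ)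
    (hbound : ∀ n : ℕ, ‖(1 - ι ∘L π) * L ^ (n + 1)‖ ≤ K * ρ ^ n) {μ : ℂ} (hμ : ρ < ‖μ‖)
    (hmem : μ ∈ spectrum ℂ L) : μ ∈ spectrum ℂ T := by
  by_contra hT
  have hb := notMem_spectrum_compression hπι hLι hρ hbound hμ
  rw [spectrum.notMem_iff, ContinuousLinearMap.isUnit_iff_bijective] at hb
  rw [spectrum.notMem_iff, Module.End.isUnit_iff] at hT
  refine hmem ?_
  change IsUnit _
  rw [ContinuousLinearMap.isUnit_iff_bijective]
  have eb : ∀ h, (algebraMap ℂ (E →L[ℂ] E) μ - (1 - ι ∘L π) * L) h =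
      μ • h - (L h - ι (π (L h))) := fun h => by simp [Algebra.algebraMap_eq_smul_one]
  have eL : ∀ h, (algebraMap ℂ (E →L[ℂ] E) μ - L) h = μ • h - L h := fun h => by
    simp [Algebra.algebraMap_eq_smul_one]
  have eT : ∀ v, (algebraMap ℂ (Module.End ℂ V) μ - T) v = μ • v - T v := fun v => by
    simp [Algebra.algebraMap_eq_smul_one]
  constructor
  · rw [injective_iff_map_eq_zero]
    intro h hh
    rw [eL, sub_eq_zero] at hh
    have h1 : h - ι (π h) = 0 := by
      apply (injective_iff_map_eq_zero _).1 hb.1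
      rw [eb]
      simp only [map_sub, hLι, hπι, ← hh, map_smul, smul_sub]
      abel
    have h2 : π h = 0 := by
      apply (injective_iff_map_eq_zero _).1 hT.1
      rw [eT, sub_eq_zero, ← hπι (T (π h)), ← hLι, ← sub_eq_zero.1 h1, ← hh, map_smul]
    rw [sub_eq_zero.1 h1, h2, map_zero]
  · intro g
    obtain ⟨h, hh⟩ := hb.2 g
    rw [eb] at hh
    -- `(μ - L) h` differs from `g` by the element `- ι (π (L h))` of the invariant subspace.
    obtain ⟨v, hv⟩ := hT.2 (π (L h))
    rw [eT] at hv
    refine ⟨h + ι v, ?_⟩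
    rw [eL, map_add, hLι, smul_add, ← hh, ← map_smul,
      show μ • v = π (L h) + T v from sub_eq_iff_eq_add.1 hv, map_add]
    abel

/-- Outside the disk of radius `ρ`, the generalized eigenvectors of `L` lie in `ι V`. -/
theorem maxGenEigenspace_eq_map [CompleteSpace E] (hπι : ∀ v, π (ι v) = v)
    (hLι : ∀ v, L (ι v) = ι (T v)) (hρ : 0 < ρ)
    (hbound : ∀ n : ℕ, ‖(1 - ι ∘L π) * L ^ (n + 1)‖ ≤ K * ρ ^ n) {μ : ℂ} (hμ : ρ < ‖μ‖) :
    Module.End.maxGenEigenspace (L : Module.End ℂ E) μ =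
      (Module.End.maxGenEigenspace T μ).map (ι : V →ₗ[ℂ] E) := by
  have hb := notMem_spectrum_compression hπι hLι hρ hbound hμ
  rw [spectrum.notMem_iff, ContinuousLinearMap.isUnit_iff_bijective] at hb
  have eb : ∀ h, (algebraMap ℂ (E →L[ℂ] E) μ - (1 - ι ∘L π) * L) h =
      μ • h - (L h - ι (π (L h))) := fun h => by simp [Algebra.algebraMap_eq_smul_one]
  have hιpow : ∀ (k : ℕ) (v : V), (((L : Module.End ℂ E) - μ • 1) ^ k) (ι v) =
      ι (((T - μ • 1) ^ k) v) := by
    intro k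
    induction k with
    | zero => simp
    | succ k ih =>
      intro v
      have : ((L : Module.End ℂ E) - μ • 1) (ι v) = ι ((T - μ • 1) v) := by simp [hLι]
      rw [pow_succ, pow_succ, Module.End.mul_apply, Module.End.mul_apply, this, ih]
  have hrange : ∀ (k : ℕ) (h : E), (((L : Module.End ℂ E) - μ • 1) ^ k) h = 0 →
      h = ι (π h) := by
    intro k
    induction k with
    | zero => intro h hh; rw [show h = 0 by simpa using hh]; simp
    | succ k ih =>
      intro h hh
      rw [pow_succ, Module.End.mul_apply] at hh
      have h1 := ih _ hh
      rw [← sub_eq_zero]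
      apply (injective_iff_map_eq_zero _).1 hb.1
      simp only [LinearMap.sub_apply, LinearMap.smul_apply, Module.End.one_apply,
        ContinuousLinearMap.coe_coe, map_sub, map_smul] at h1
      have e : (algebraMap ℂ (E →L[ℂ] E) μ - (1 - ι ∘L π) * L) (h - ι (π h)) =
          (ι (π (L h)) - μ • ι (π h)) - (L h - μ • h) := by
        rw [eb]
        simp only [map_sub, hLι, hπι, smul_sub]
        abel
      rw [e, h1]
      abel
  ext h
  rw [Submodule.mem_map]
  simp only [Module.End.mem_maxGenEigenspace]
  constructor
  · rintro ⟨k, hk⟩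
    have h1 := hrange k h hk
    refine ⟨π h, ⟨k, ?_⟩, h1.symm⟩
    rw [h1, hιpow] at hk
    rw [← hπι (((T - μ • 1) ^ k) (π h)), hk, map_zero]
  · rintro ⟨v, ⟨k, hk⟩, rfl⟩
    exact ⟨k, by rw [ContinuousLinearMap.coe_coe, hιpow, hk, map_zero]⟩

end BlockTriangular

/-! ### Bounded holomorphic functions on a disk -/

section HInf

variable {c : ℂ} {R : ℝ}

theorem HInf.eval_of_mem (h : HInf c R) {z : ℂ} (hz : z ∈ Metric.ball c R) :
    HInf.eval h z = h.1 ⟨z, hz⟩ := dif_pos hz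

theorem HInf.norm_eval_le (h : HInf c R) (z : ℂ) : ‖HInf.eval h z‖ ≤ ‖h‖ := by
  by_cases hz : z ∈ Metric.ball c R
  · rw [HInf.eval_of_mem h hz]
    exact h.1.norm_coe_le_norm _
  · rw [MarkovTransfer.HInf.eval, dif_neg hz, norm_zero]
    exact norm_nonneg _

theorem HInf.differentiableOn_eval (h : HInf c R) :
    DifferentiableOn ℂ (HInf.eval h) (Metric.ball c R) := by
  obtain ⟨g, hg, e⟩ := h.2
  exact hg.congr fun z hz => by rw [HInf.eval_of_mem h hz, e]

/-- `H^∞(D)` is complete, since locally uniform limits of holomorphic functions are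
holomorphic. -/
instance HInf.instCompleteSpace (c : ℂ) (R : ℝ) : CompleteSpace (HInf c R) := by
  have hcl : IsClosed (HInf c R : Set (BoundedContinuousFunction (Metric.ball c R) ℂ)) := by
    refine IsSeqClosed.isClosed fun F f hF hlim => ?_
    classical
    set g : ℂ → ℂ := fun z => if hz : z ∈ Metric.ball c R then f ⟨z, hz⟩ else 0 with hg
    have hgf : ∀ z (hz : z ∈ Metric.ball c R), g z = f ⟨z, hz⟩ := fun z hz => dif_pos hz
    refine ⟨g, ?_, fun z => (hgf z z.2).symm⟩
    have hunif : TendstoUniformlyOn (fun n => HInf.eval ⟨F n, hF n⟩) g Filter.atTop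
        (Metric.ball c R) := by
      rw [BoundedContinuousFunction.tendsto_iff_tendstoUniformly] at hlim
      rw [Metric.tendstoUniformlyOn_iff]
      intro ε hε
      filter_upwards [Metric.tendstoUniformly_iff.1 hlim ε hε] with n hn z hz
      rw [hgf z hz, HInf.eval_of_mem _ hz]
      exact hn _
    exact hunif.tendstoLocallyUniformlyOn.differentiableOn
      (Filter.Eventually.of_forall fun n => HInf.differentiableOn_eval _) Metric.isOpen_ball
  exact hcl.completeSpace_coe

/-- A bounded holomorphic function on a disk is Lipschitz on smaller concentric disks, by Cauchy's
estimate for its derivative. -/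
theorem HInf.norm_eval_sub_le {r : ℝ} (hrR : r < R) (h : HInf c R) {z w : ℂ}
    (hz : z ∈ Metric.ball c r) (hw : w ∈ Metric.ball c r) :
    ‖HInf.eval h z - HInf.eval h w‖ ≤ ‖h‖ / ((R - r) / 2) * ‖z - w‖ := by
  have hs : 0 < (R - r) / 2 := by linarith
  have hsub : ∀ y ∈ Metric.ball c r, Metric.closedBall y ((R - r) / 2) ⊆ Metric.ball c R := by
    intro y hy
    apply Metric.closedBall_subset_ball'
    rw [Metric.mem_ball] at hy
    linarith
  refine Convex.norm_image_sub_le_of_norm_deriv_le (𝕜 := ℂ) (fun y hy => ?_) (fun y hy => ?_)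
    (convex_ball c r) hw hz
  · exact (HInf.differentiableOn_eval h).differentiableAt
      (Metric.isOpen_ball.mem_nhds (Metric.ball_subset_ball hrR.le hy))
  · refine Complex.norm_deriv_le_of_forall_mem_sphere_norm_le hs ?_ fun y _ => HInf.norm_eval_le h y
    exact ((HInf.differentiableOn_eval h).mono (hsub y hy)).diffContOnCl_ball le_rfl

end HInf

/-! ### Constant tuples and evaluation -/

/-- The embedding of `ℂ ^ N` into `𝓗(D)` as the tuples of constant functions. -/
def constMap (N : ℕ) (c : ℂ) (R : ℝ) : (Fin N → ℂ) →L[ℂ] HSpace N c R :=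
  LinearMap.toContinuousLinearMap
    { toFun := fun v k => ⟨BoundedContinuousFunction.const _ (v k),
        fun _ => v k, differentiableOn_const _, fun _ => rfl⟩
      map_add' := fun _ _ => rfl
      map_smul' := fun _ _ => rfl }

/-- Evaluation of the components of an element of `𝓗(D)` at a point of the disk. -/
def evalMap (N : ℕ) {c : ℂ} {R : ℝ} (z : Metric.ball c R) : HSpace N c R →L[ℂ] (Fin N → ℂ) :=
  ContinuousLinearMap.pi fun k =>
    BoundedContinuousFunction.evalCLM ℂ z ∘L (HInf c R).subtypeL ∘L ContinuousLinearMap.proj k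

theorem evalMap_constMap {N : ℕ} {c : ℂ} {R : ℝ} (z : Metric.ball c R) (v : Fin N → ℂ) :
    evalMap N z (constMap N c R v) = v := rfl

theorem eval_constMap {N : ℕ} {c : ℂ} {R : ℝ} (v : Fin N → ℂ) (k : Fin N) {z : ℂ}
    (hz : z ∈ Metric.ball c R) : HInf.eval (constMap N c R v k) z = v k :=
  HInf.eval_of_mem _ hz

variable {N : ℕ} {M : PLExpandingMarkovMap N}

/-! ### The diagonal blocks -/

theorem transitionMatrix_eq_zero_or_one (k l : Fin N) :
    M.transitionMatrix k l = 0 ∨ M.transitionMatrix k l = 1 := by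
  simp only [transitionMatrix, of_apply]
  split_ifs <;> simp

theorem abs_slope_rpow_pos (β : ℝ) (l : Fin N) : 0 < |M.slope l| ^ β :=
  Real.rpow_pos_of_pos (abs_pos.2 (M.slope_ne_zero l)) β

theorem diagBlock_zero_apply (β : ℝ) (k l : Fin N) :
    M.diagBlock 0 β k l = M.transitionMatrix l k / |M.slope l| ^ β := by
  simp [diagBlock]

theorem diagBlock_zero_nonneg (β : ℝ) (k l : Fin N) : 0 ≤ M.diagBlock 0 β k l := by
  rw [diagBlock_zero_apply]
  refine div_nonneg ?_ (abs_slope_rpow_pos β l).le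
  rcases transitionMatrix_eq_zero_or_one (M := M) l k with h | h <;> simp [h]

/-- The matrix `T^{(00)}(β)` dominates a positive multiple of the transpose of the transition
matrix, so topological mixing makes it primitive. -/
theorem isPrimitive_diagBlock_zero [Nonempty (Fin N)] (hmix : M.IsTopologicallyMixing) (β : ℝ) :
    (M.diagBlock 0 β).IsPrimitive := by
  obtain ⟨p, hp, hpos⟩ := hmix
  refine ⟨diagBlock_zero_nonneg β, p, hp, ?_⟩
  obtain ⟨ε, hε, hεle⟩ : ∃ ε > 0, ∀ l, ε * |M.slope l| ^ β ≤ 1 :=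
    exists_pos_mul_le (abs_slope_rpow_pos β) fun _ => one_pos
  have hA : ∀ k l, 0 ≤ M.transitionMatrix k l := fun k l => by
    rcases transitionMatrix_eq_zero_or_one (M := M) k l with h | h <;> simp [h]
  have hle : ∀ k l, ε * M.transitionMatrix l k ≤ M.diagBlock 0 β k l := fun k l => by
    rw [diagBlock_zero_apply, le_div_iff₀ (abs_slope_rpow_pos β l)]
    nlinarith [hA l k, hεle l]
  have hpow : ∀ n k l, 0 ≤ (M.transitionMatrix ^ n) l k ∧
      ε ^ n * (M.transitionMatrix ^ n) l k ≤ (M.diagBlock 0 β ^ n) k l := by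
    intro n
    induction n with
    | zero =>
      intro k l
      rw [pow_zero, pow_zero, pow_zero, one_mul, one_apply, one_apply]
      by_cases h : k = l
      · simp [h]
      · simp [h, Ne.symm h]
    | succ n ih =>
      intro k l
      rw [pow_succ' M.transitionMatrix, pow_succ (M.diagBlock 0 β), mul_apply, mul_apply]
      refine ⟨Finset.sum_nonneg fun j _ => mul_nonneg (hA _ _) (ih _ _).1, ?_⟩
      rw [Finset.mul_sum]
      refine Finset.sum_le_sum fun j _ => ?_
      calc ε ^ (n + 1) * (M.transitionMatrix l j * (M.transitionMatrix ^ n) j k)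
          = (ε ^ n * (M.transitionMatrix ^ n) j k) * (ε * M.transitionMatrix l j) := by ring
        _ ≤ _ := by
          have h1 := (ih k j).1
          have h2 := hA l j
          exact mul_le_mul (ih k j).2 (hle j l) (by positivity)
            ((by positivity : (0 : ℝ) ≤ _).trans (ih k j).2)
  exact fun k l => (mul_pos (pow_pos hε p) (hpos l k)).trans_le (hpow p k l).2

theorem abs_diagBlock_le {C : ℝ} (hC : ∀ l, |M.slope l|⁻¹ ≤ C) {m : ℕ} (hm : 1 ≤ m) (β : ℝ)
    (k l : Fin N) : |M.diagBlock m β k l| ≤ C * M.diagBlock 0 β k l := by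
  have h1 : |M.diagBlock m β k l| = (|M.slope l|⁻¹) ^ m * M.diagBlock 0 β k l := by
    have : M.diagBlock m β k l = (M.slope l ^ m)⁻¹ * M.diagBlock 0 β k l := by
      simp only [diagBlock, of_apply, pow_zero, mul_one]
      rw [div_mul_eq_div_div, div_eq_inv_mul]
    rw [this, abs_mul, abs_of_nonneg (diagBlock_zero_nonneg β k l), abs_inv, abs_pow, inv_pow]
  rw [h1]
  refine mul_le_mul_of_nonneg_right ?_ (diagBlock_zero_nonneg β k l)
  exact (pow_le_of_le_one (inv_nonneg.2 (abs_nonneg _)) (inv_le_one_of_one_le₀ (M.expanding l).le)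
    (by omega)).trans (hC l)

/-! ### The transfer operator modulo constants -/

variable (D : M.AdaptedDisks) (β : ℝ)

/-- The matrix form of `𝓛_β`. Where `A_{lk} = 0` the coefficient vanishes, so it does not matter that
`φ_{kl}(z)` may lie outside the disk. -/
theorem eval_transferOp (h : HSpace N D.c D.R) (k : Fin N) {z : ℂ}
    (hz : z ∈ Metric.ball D.c D.R) :
    HInf.eval (transferOp D β h k) z =
      ∑ l, (M.diagBlock 0 β k l : ℂ) * HInf.eval (h l) (M.invBranch l z) := by
  classical
  rw [HInf.eval_of_mem _ hz]
  simp only [transferOp, ContinuousLinearMap.coe_pi', _root_.sum_apply]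
  rw [Submodule.coe_sum, BoundedContinuousFunction.coe_sum, Finset.sum_apply]
  refine Finset.sum_congr rfl fun l _ => ?_
  rw [diagBlock_zero_apply]
  rcases transitionMatrix_eq_zero_or_one (M := M) l k with hA | hA
  · rw [dif_neg (by rw [hA]; exact zero_ne_one), hA]
    simp
  · rw [dif_pos hA, hA, HInf.eval_of_mem _ (D.mapsTo_self k l hA hz), one_div]
    rfl

/-- The constant tuples are invariant under `𝓛_β`, which acts on them as the matrix
`T^{(00)}(β)`. -/
theorem transferOp_constMap (v : Fin N → ℂ) :
    transferOp D β (constMap N D.c D.R v) =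
      constMap N D.c D.R (toLin' ((M.diagBlock 0 β).map (algebraMap ℝ ℂ)) v) := by
  ext k z
  rw [← HInf.eval_of_mem _ z.2, ← HInf.eval_of_mem _ z.2, eval_transferOp D β _ k z.2,
    eval_constMap _ _ z.2]
  refine Finset.sum_congr rfl fun l _ => ?_
  rcases transitionMatrix_eq_zero_or_one (M := M) l k with hA | hA
  · simp [diagBlock_zero_apply, hA]
  · rw [eval_constMap _ _ (D.mapsTo_self k l hA z.2)]
    rfl

variable {ν C : ℝ} {x : Fin N → ℝ}

/-- Since the inverse branches contract by the factor `C`, the transfer operator multiplies Lipschitz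
constants by `C ν`, when these are measured relative to the Perron eigenvector `x`. -/
theorem norm_eval_transferOp_sub_le (hC : ∀ l, |M.slope l|⁻¹ ≤ C) (hx : ∀ l, 0 < x l)
    (hTx : M.diagBlock 0 β *ᵥ x = ν • x) {B : ℝ} (hB : 0 ≤ B) {h : HSpace N D.c D.R}
    (hh : ∀ l, ∀ z ∈ Metric.ball D.c D.r, ∀ w ∈ Metric.ball D.c D.r,
      ‖HInf.eval (h l) z - HInf.eval (h l) w‖ ≤ B * x l * ‖z - w‖) (k : Fin N)
    {z w : ℂ} (hz : z ∈ Metric.ball D.c D.R) (hw : w ∈ Metric.ball D.c D.R) :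
    ‖HInf.eval (transferOp D β h k) z - HInf.eval (transferOp D β h k) w‖ ≤
      B * (C * ν) * x k * ‖z - w‖ := by
  rw [eval_transferOp D β h k hz, eval_transferOp D β h k hw, ← Finset.sum_sub_distrib]
  have hTxk : ∑ l, M.diagBlock 0 β k l * x l = ν * x k := congrFun hTx k
  calc ‖∑ l, ((M.diagBlock 0 β k l : ℂ) * HInf.eval (h l) (M.invBranch l z) -
        (M.diagBlock 0 β k l : ℂ) * HInf.eval (h l) (M.invBranch l w))‖
      ≤ ∑ l, M.diagBlock 0 β k l * (B * x l * (C * ‖z - w‖)) := by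
        refine (norm_sum_le _ _).trans (Finset.sum_le_sum fun l _ => ?_)
        rw [← mul_sub, norm_mul, Complex.norm_real,
          Real.norm_of_nonneg (diagBlock_zero_nonneg β k l)]
        rcases transitionMatrix_eq_zero_or_one (M := M) l k with hA | hA
        · simp [diagBlock_zero_apply, hA]
        · refine mul_le_mul_of_nonneg_left ?_ (diagBlock_zero_nonneg β k l)
          refine (hh l _ (D.mapsTo k l hA hz) _ (D.mapsTo k l hA hw)).trans ?_
          refine mul_le_mul_of_nonneg_left ?_ (mul_nonneg hB (hx l).le)
          have e : M.invBranch l z - M.invBranch l w = (M.slope l : ℂ)⁻¹ * (z - w) := by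
            simp only [invBranch]
            ring
          rw [e, norm_mul, norm_inv, Complex.norm_real, Real.norm_eq_abs]
          exact mul_le_mul_of_nonneg_right (hC l) (norm_nonneg _)
    _ = B * C * ‖z - w‖ * ∑ l, M.diagBlock 0 β k l * x l := by
        rw [Finset.mul_sum]
        exact Finset.sum_congr rfl fun l _ => by ring
    _ = _ := by rw [hTxk]; ring

set_option synthInstance.maxHeartbeats 100000 in
/-- Each application of `𝓛_β` gains a factor `C ν`; as the branches map `D_R` into `D_r`, a Lipschitz
bound on `D_r` becomes one on all of `D_R` already after the first application. -/
theorem norm_eval_transferOp_pow_sub_le (hC : ∀ l, |M.slope l|⁻¹ ≤ C) (hCν : 0 ≤ C * ν)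
    (hx : ∀ l, 0 < x l) (hTx : M.diagBlock 0 β *ᵥ x = ν • x) {B : ℝ} (hB : 0 ≤ B)
    {h : HSpace N D.c D.R}
    (hh : ∀ l, ∀ z ∈ Metric.ball D.c D.r, ∀ w ∈ Metric.ball D.c D.r,
      ‖HInf.eval (h l) z - HInf.eval (h l) w‖ ≤ B * x l * ‖z - w‖) (n : ℕ) (k : Fin N)
    {z w : ℂ} (hz : z ∈ Metric.ball D.c D.R) (hw : w ∈ Metric.ball D.c D.R) :
    ‖HInf.eval ((transferOp D β ^ (n + 1)) h k) z - HInf.eval ((transferOp D β ^ (n + 1)) h k) w‖ ≤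
      B * (C * ν) ^ (n + 1) * x k * ‖z - w‖ := by
  induction n generalizing k z w with
  | zero => simpa using norm_eval_transferOp_sub_le D β hC hx hTx hB hh k hz hw
  | succ n ih =>
    have hsub := Metric.ball_subset_ball (x := D.c) D.r_lt_R.le
    have h1 := norm_eval_transferOp_sub_le D β hC hx hTx
      (h := (transferOp D β ^ (n + 1)) h) (B := B * (C * ν) ^ (n + 1)) (by positivity)
      (fun l z hz w hw => ih l (hsub hz) (hsub hw)) k hz hw
    rw [pow_succ' (transferOp D β), pow_succ (C * ν), ← mul_assoc]
    exact h1

/-- The centre of the disk `D_R`. -/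
def diskCenter (D : M.AdaptedDisks) : Metric.ball D.c D.R :=
  ⟨D.c, Metric.mem_ball_self (D.r_pos.trans D.r_lt_R)⟩

/-- Modulo constants, the powers of the transfer operator decay like `(C ν) ^ n`. -/
theorem exists_norm_transferOp_pow_le [Nonempty (Fin N)] (hC : ∀ l, |M.slope l|⁻¹ ≤ C)
    (hCν : 0 ≤ C * ν) (hx : ∀ l, 0 < x l) (hTx : M.diagBlock 0 β *ᵥ x = ν • x) :
    ∃ K : ℝ, ∀ n : ℕ,
      ‖(1 - constMap N D.c D.R ∘L evalMap N (diskCenter D)) * transferOp D β ^ (n + 1)‖ ≤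
        K * (C * ν) ^ n := by
  obtain ⟨δ, hδ, hδle⟩ : ∃ δ > 0, ∀ l, δ * 1 ≤ x l := exists_pos_mul_le (fun _ => one_pos) hx
  have hR : 0 < D.R := D.r_pos.trans D.r_lt_R
  have hRr : 0 < (D.R - D.r) / 2 := by have := D.r_lt_R; linarith
  have hxs : 0 ≤ ∑ k, x k := Finset.sum_nonneg fun k _ => (hx k).le
  refine ⟨((D.R - D.r) / 2 * δ)⁻¹ * (C * ν) * (∑ k, x k) * D.R, fun n => ?_⟩
  refine ContinuousLinearMap.opNorm_le_bound _ (by positivity) fun h => ?_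
  -- Cauchy's estimate on `D_r`, with the lower bound `δ ≤ x l` used to express the Lipschitz constant
  -- relative to `x`.
  set B := ‖h‖ * ((D.R - D.r) / 2 * δ)⁻¹ with hB
  have hB0 : 0 ≤ B := by positivity
  have hh : ∀ l, ∀ z ∈ Metric.ball D.c D.r, ∀ w ∈ Metric.ball D.c D.r,
      ‖HInf.eval (h l) z - HInf.eval (h l) w‖ ≤ B * x l * ‖z - w‖ := by
    intro l z hz w hw
    refine (HInf.norm_eval_sub_le D.r_lt_R (h l) hz hw).trans ?_
    refine mul_le_mul_of_nonneg_right ?_ (norm_nonneg _)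
    calc ‖h l‖ / ((D.R - D.r) / 2) ≤ ‖h‖ / ((D.R - D.r) / 2) := by
          gcongr
          exact norm_le_pi_norm h l
      _ = B * (δ * 1) := by rw [hB]; field_simp
      _ ≤ B * x l := mul_le_mul_of_nonneg_left (hδle l) hB0
  refine (pi_norm_le_iff_of_nonneg (by positivity)).2 fun k => ?_
  refine (BoundedContinuousFunction.norm_le (by positivity)).2 fun z => ?_
  set g := (transferOp D β ^ (n + 1)) h with hg
  have hc : D.c ∈ Metric.ball D.c D.R := (diskCenter D).2
  have e : (((1 - constMap N D.c D.R ∘L evalMap N (diskCenter D)) *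
      transferOp D β ^ (n + 1)) h k).1 z = HInf.eval (g k) z - HInf.eval (g k) D.c := by
    rw [HInf.eval_of_mem _ z.2, HInf.eval_of_mem _ hc]
    rfl
  refine (congrArg norm e).trans_le ?_
  refine (norm_eval_transferOp_pow_sub_le D β hC hCν hx hTx hB0 hh n k z.2 hc).trans ?_
  have hz : ‖(z : ℂ) - D.c‖ ≤ D.R := (mem_ball_iff_norm.1 z.2).le
  calc B * (C * ν) ^ (n + 1) * x k * ‖(z : ℂ) - D.c‖
      ≤ B * (C * ν) ^ (n + 1) * (∑ k, x k) * D.R := by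
        gcongr
        exact Finset.single_le_sum (fun j _ => (hx j).le) (Finset.mem_univ k)
    _ = _ := by rw [hB]; ring

end MarkovTransfer

end

/-! ### The leading eigenvalue -/

theorem corollary1 {N : ℕ} (M : MarkovTransfer.PLExpandingMarkovMap N) (D : M.AdaptedDisks)
    (hmix : M.IsTopologicallyMixing) (β : ℝ) :
    ∃ ν₀ : ℝ,
      MarkovTransfer.IsSimplePositiveLeadingEigenvalue
        (MarkovTransfer.PLExpandingMarkovMap.transferOp D β) ν₀ ∧
      MarkovTransfer.IsPerronEigenvalue (M.diagBlock 0 β) ν₀ ∧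
      1 / (⨅ l, |M.slope l|) < 1 ∧
      ∀ m : ℕ, 1 ≤ m →
        spectralRadius ℂ ((M.diagBlock m β).map (algebraMap ℝ ℂ)) ≤
          ENNReal.ofReal (1 / (⨅ l, |M.slope l|) * ν₀) := by
  open MarkovTransfer in
  have hne : Nonempty (Fin N) := by
    have ha : M.a ∈ ⋃ k, Set.Icc (M.lo k) (M.hi k) := by
      rw [M.iUnion_eq]
      exact Set.left_mem_Icc.2 M.a_lt_b.le
    exact (Set.mem_iUnion.1 ha).nonempty
  have hinf : 1 < ⨅ l, |M.slope l| := by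
    obtain ⟨l₀, h⟩ := exists_eq_ciInf_of_finite (f := fun l => |M.slope l|)
    rw [← h]
    exact M.expanding l₀
  set C := 1 / (⨅ l, |M.slope l|) with hCdef
  have hC0 : 0 < C := one_div_pos.2 (one_pos.trans hinf)
  have hC1 : C < 1 := (div_lt_one (one_pos.trans hinf)).2 hinf
  have hC : ∀ l, |M.slope l|⁻¹ ≤ C := fun l => by
    rw [hCdef, one_div]
    exact inv_anti₀ (one_pos.trans hinf) (ciInf_le (Set.finite_range _).bddBelow l)
  have hT := isPrimitive_diagBlock_zero hmix β
  obtain ⟨ν, hν, x, u, hx, hu, hTx, hTu⟩ := exists_pos_left_right_eigenvector hT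
  have hperron := isPerronEigenvalue_of_isPrimitive hT hν hu hTu hx hTx
  have hCν : 0 < C * ν := mul_pos hC0 hν
  have hCν1 : C * ν < ν := mul_lt_of_lt_one_left hν hC1
  obtain ⟨K, hK⟩ := exists_norm_transferOp_pow_le D β hC hCν.le hx hTx
  have hνn : C * ν < ‖(ν : ℂ)‖ := by rwa [Complex.norm_real, Real.norm_of_nonneg hν.le]
  have hπι := evalMap_constMap (N := N) (diskCenter D)
  have hLι := transferOp_constMap D β
  have hsimple : Module.finrank ℂ (Module.End.maxGenEigenspace
      (PLExpandingMarkovMap.transferOp D β : Module.End ℂ (HSpace N D.c D.R)) (ν : ℂ)) = 1 := by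
    rw [maxGenEigenspace_eq_map hπι hLι hCν hK hνn,
      ← finrank_maxGenEigenspace_toLin'_eq_one hT hν hu hTu hx hTx]
    exact (Submodule.equivMapOfInjective _ (Function.LeftInverse.injective hπι) _).finrank_eq.symm
  refine ⟨ν, ⟨hν, ?_, hsimple, fun μ hμ hne => ?_⟩, hperron, hC1, fun m hm =>
    spectralRadius_map_le_of_abs_le (abs_diagBlock_le hC hm β) hu hTu⟩
  · exact hasEigenvalue_of_finrank_maxGenEigenspace_ne_zero (by rw [hsimple]; exact one_ne_zero)
  -- A spectral value of modulus at most `C ν` is small enough; any other is an eigenvalue of the block.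
  · rcases le_or_gt ‖μ‖ (C * ν) with h | h
    · exact h.trans_lt hCν1
    · have h1 := mem_spectrum_restriction_of_mem_spectrum hπι hLι hCν hK h hμ
      rw [Matrix.spectrum_toLin'] at h1
      exact hperron.leading μ h1 hne
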